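/- Notation. $\log$ is the principal logarithm ($-\pi<\arg\le\pi$), $0\cdot\log 0:=0$, $z=x+\mathrm i y\in\mathbb C$ with $x,y$ real, and $\delta_{ab}$ is the Kronecker delta. $P_k$ are the Legendre polynomials ($P_k(1)=1$), with $P_{-1}:=0$. For real $\lambda$ the ultraspherical polynomials $C^{(\lambda)}_n$ are given by $C_0^{(\lambda)}=1$, $C_1^{(\lambda)}(x)=2\lambda x$, $(n+1)C^{(\lambda)}_{n+1}(x)=2(n+\lambda)xC^{(\lambda)}_n(x)-(n+2\lambda-1)C^{(\lambda)}_{n-1}(x)$ for $n\ge1$. For $k,j\ge -1$ put \[ L_{kj}(z)=\int_{-1}^1\!\int_{-1}^1\log(z-(s+\mathrm i t))P_k(s)P_j(t)\,ds\,dt,\quad L_k(z)=\int_{-1}^1\log(z-t)P_k(t)\,dt,\quad M_k(z)=\int_{-1}^1\log(z-\mathrm i t)P_k(t)\,dt, \] so these vanish if an index is $-1$. Let $\log_-z=\log|z|-\mathrm i\pi$ if $y=0$, $x<0$, and $\log_-z=\log z$ otherwise. For $k,j\ge 0$ define \[ \lambda_k(z)=\begin{cases}(z-1)\log(z-1)+(z+1)\log(z+1)&k=0\\-2/3&k=1\\0&k\ge2,\end{cases}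 \] \[ \mu_k(z)=\begin{cases}(z-\mathrm i)\log(z-\mathrm i)+(z+\mathrm i)\log_-(z+\mathrm i)&k=0\\-2\mathrm i/3&k=1\\0&k\ge2\end{cases}\;-\;\begin{cases}2\mathrm i\pi x\,C^{(-1/2)}_{k+1}(y)&x<0,\ -1<y<1\\0&\text{otherwise,}\end{cases} \] \[ \beta_{kj}(z)=2\mathrm i\pi\,C^{(-1/2)}_{j+1}(y)\begin{cases}\tfrac13C^{(-3/2)}_{k+2}(x)-\delta_{k0}x+\tfrac13\delta_{k1}&-1\le x\le1,\ -1\le y<1\\-2x\delta_{k0}+\tfrac23\delta_{k1}&x<-1,\ -1\le y<1\\0&\text{otherwise,}\end{cases} \] \[ F^{(1)}_{kj}(z)=\begin{cases}\mathrm i\,\dfrac{M_{j+1}(z-1)+M_{j+1}(z+1)-M_{j-1}(z-1)-M_{j-1}(z+1)}{2j+1}+\mu_j(z-1)+\mu_j(z+1)&k=0\\-4/3&(k,j)=(1,0)\\0&\text{otherwise,}\end{cases} \] \[ F^{(2)}_{kj}(z)=\begin{cases}\dfrac{L_{k+1}(z-\mathrm i)+L_{k+1}(z+\mathrm i)-L_{k-1}(z-\mathrm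 i)-L_{k-1}(z+\mathrm i)}{2k+1}+\lambda_k(z-\mathrm i)+\lambda_k(z+\mathrm i)+\beta_{k0}(z)&j=0\\-4\mathrm i/3+\beta_{01}(z)&(k,j)=(0,1)\\\beta_{kj}(z)&\text{otherwise.}\end{cases} \] Corollary. For all $z\in\mathbb C$ and all integers $k,j\ge0$, \[ zL_{k0}(z)=\frac{k-2}{2k+1}L_{k-1,0}(z)+\frac{k+3}{2k+1}L_{k+1,0}(z)+2F^{(1)}_{k0}(z)-F^{(2)}_{k0}(z), \] \[ zL_{0j}(z)=\mathrm i\,\frac{j-2}{2j+1}L_{0,j-1}(z)+\mathrm i\,\frac{j+3}{2j+1}L_{0,j+1}(z)+2F^{(2)}_{0j}(z)-F^{(1)}_{0j}(z). \] -/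

import Mathlib

noncomputable section

namespace SquareLog

/-- The Legendre polynomial `P_n` for `n : ℕ` (normalised by `P_n(1) = 1`), as a function on `ℝ`,
by the three-term recurrence `(n+2) P_{n+2}(x) = (2n+3) x P_{n+1}(x) - (n+1) P_n(x)`. -/
def legendreNat : ℕ → ℝ → ℝ
  | 0, _ => 1
  | 1, x => x
  | n + 2, x => ((2 * (n : ℝ) + 3) * x * legendreNat (n + 1) x
      - ((n : ℝ) + 1) * legendreNat n x) / ((n : ℝ) + 2)

/-- Legendre polynomials indexed by the integers, with the convention `P_k = 0` for `k < 0`. -/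
def legendre (k : ℤ) (x : ℝ) : ℝ :=
  if k < 0 then 0 else legendreNat k.toNat x

/-- The ultraspherical (Gegenbauer) polynomial `C_n^{(lam)}`, as a function on `ℝ`, by
`(n+2) C_{n+2}(x) = 2 (n+1+lam) x C_{n+1}(x) - (n+2 lam) C_n(x)`, `C_0 = 1`, `C_1 = 2 lam x`.
This makes sense for every real `lam`, in particular for `-1/2` and `-3/2`. -/
def ultraspherical (lam : ℝ) : ℕ → ℝ → ℝ
  | 0, _ => 1
  | 1, x => 2 * lam * x
  | n + 2, x => (2 * ((n : ℝ) + 1 + lam) * x * ultraspherical lam (n + 1) x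
      - ((n : ℝ) + 2 * lam) * ultraspherical lam n x) / ((n : ℝ) + 2)

/-- The square `Ω = [-1,1] × [-1,1]`. -/
def square : Set (ℝ × ℝ) := Set.Icc (-1) 1 ×ˢ Set.Icc (-1) 1

/-- `∬_Ω log (z - (s + i t)) f(s,t) ds dt`, with the principal branch of the logarithm. -/
def logSquare (f : ℝ → ℝ → ℝ) (z : ℂ) : ℂ :=
  ∫ p in square, Complex.log (z - ((p.1 : ℂ) + Complex.I * (p.2 : ℂ))) * (f p.1 p.2 : ℂ)

/-- `∫_{-1}^1 log (z - t) f(t) dt`. -/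
def logInterval (f : ℝ → ℝ) (z : ℂ) : ℂ :=
  ∫ t in (-1 : ℝ)..1, Complex.log (z - (t : ℂ)) * (f t : ℂ)

/-- `∫_{-1}^1 log (z - i t) f(t) dt`. -/
def logIntervalI (f : ℝ → ℝ) (z : ℂ) : ℂ :=
  ∫ t in (-1 : ℝ)..1, Complex.log (z - Complex.I * (t : ℂ)) * (f t : ℂ)

/-- The two-dimensional complex logarithmic integral `L_{kj}(z)`; it is `0` if `k < 0` or
`j < 0`. -/
def L2 (k j : ℤ) (z : ℂ) : ℂ := logSquare (fun s t => legendre k s * legendre j t) z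

/-- The one-dimensional complex logarithmic integral `L_k(z)`; it is `0` if `k < 0`. -/
def L1 (k : ℤ) (z : ℂ) : ℂ := logInterval (legendre k) z

/-- The one-dimensional integral `M_k(z)`; it is `0` if `k < 0`. -/
def M1 (k : ℤ) (z : ℂ) : ℂ := logIntervalI (legendre k) z

/-- The logarithm with the other limit along its branch cut: `log|z| - i π` for `z` real and
negative, and the principal value otherwise. -/
def logMinus (z : ℂ) : ℂ :=
  if z.im = 0 ∧ z.re < 0 then (Real.log ‖z‖ : ℂ) - Complex.I * (Real.pi : ℂ) else Complex.log z

/-- The inhomogeneity `λ_k(z)` of the three-term recurrence of `L_k(z)`. -/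
def lambda (k : ℕ) (z : ℂ) : ℂ :=
  if k = 0 then (z - 1) * Complex.log (z - 1) + (z + 1) * Complex.log (z + 1)
  else if k = 1 then -2 / 3
  else 0

/-- The inhomogeneity `μ_k(z)` of the three-term recurrence of `M_k(z)`. -/
def mu (k : ℕ) (z : ℂ) : ℂ :=
  (if k = 0 then
      (z - Complex.I) * Complex.log (z - Complex.I) + (z + Complex.I) * logMinus (z + Complex.I)
    else if k = 1 then -2 * Complex.I / 3
    else 0)
  - (if z.re < 0 ∧ -1 < z.im ∧ z.im < 1 then
      2 * Complex.I * (Real.pi : ℂ) * (z.re : ℂ) * (ultraspherical (-1 / 2) (k + 1) z.im : ℂ)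
    else 0)

/-- The Kronecker delta. -/
def delta (a b : ℕ) : ℝ := if a = b then 1 else 0

/-- The term `β_{kj}(z)` produced by the branch cut of the logarithm. The half-open condition
`-1 ≤ y < 1` in both cases is the one that goes with the principal branch (continuous from above
on its cut), which enters the one-dimensional integrals at `z ± i`. -/
def beta (k j : ℕ) (z : ℂ) : ℂ :=
  2 * Complex.I * (Real.pi : ℂ) * (ultraspherical (-1 / 2) (j + 1) z.im : ℂ) *
    (((if (-1 ≤ z.re ∧ z.re ≤ 1) ∧ (-1 ≤ z.im ∧ z.im < 1) then
        ultraspherical (-3 / 2) (k + 2) z.re / 3 - delta k 0 * z.re + delta k 1 / 3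
      else if z.re < -1 ∧ (-1 ≤ z.im ∧ z.im < 1) then
        -2 * z.re * delta k 0 + 2 * delta k 1 / 3
      else 0 : ℝ)) : ℂ)

/-- The inhomogeneity `F^{(1)}_{kj}(z)`. -/
def F1 (k j : ℕ) (z : ℂ) : ℂ :=
  if k = 0 then
    Complex.I * (M1 ((j : ℤ) + 1) (z - 1) + M1 ((j : ℤ) + 1) (z + 1)
      - M1 ((j : ℤ) - 1) (z - 1) - M1 ((j : ℤ) - 1) (z + 1)) / (2 * (j : ℂ) + 1)
    + mu j (z - 1) + mu j (z + 1)
  else if k = 1 ∧ j = 0 then -4 / 3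
  else 0

/-- The inhomogeneity `F^{(2)}_{kj}(z)`. -/
def F2 (k j : ℕ) (z : ℂ) : ℂ :=
  if j = 0 then
    (L1 ((k : ℤ) + 1) (z - Complex.I) + L1 ((k : ℤ) + 1) (z + Complex.I)
      - L1 ((k : ℤ) - 1) (z - Complex.I) - L1 ((k : ℤ) - 1) (z + Complex.I)) / (2 * (k : ℂ) + 1)
    + lambda k (z - Complex.I) + lambda k (z + Complex.I) + beta k 0 z
  else if k = 0 ∧ j = 1 then -4 * Complex.I / 3 + beta 0 1 z
  else beta k j z

end SquareLog

end

/-! Put `w = z - (s + i t)`. Writing `z = w + s + i t` under the integral, `z L_{kj}` becomes `A = ∬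
w log w P_k P_j` plus the integrals with `s P_k` and `i t P_j`, which the Legendre recurrence
expands. Since `(w log w)' = log w + 1`, integrating `A` by parts in `s` gives `(L_{k+1,j} -
L_{k-1,j})/(2k+1) + F1`, and in `t` gives `i (L_{k,j+1} - L_{k,j-1})/(2j+1) + F2`
(`mulLogSquare_legendre_left`, `mulLogSquare_legendre_right`). For `j = 0` the unwanted term is `i
L_{k1}`, and the second formula says it equals `A - F2`. Hence `z L_{k0}` is `2A - F2` plus the `s
P_k` terms, and inserting the first formula for `A` gives the claim. The case `k = 0` is the mirror
image. The care lies in the branch cut. Horizontal segments never cross it, so `s` produces no jump.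
Vertical segments cross it when `Re (z - s) < 0`, and the jump `2πi` of the logarithm produces
`beta` and the last term of `mu`; see `integral_mul_log_sub_ofReal` and
`integral_mul_log_sub_I_mul`. -/

namespace SquareLog

/-! ### Ultraspherical polynomials: recurrence, connection formula, derivative. -/

theorem legendreNat_eq_ultraspherical (n : ℕ) (x : ℝ) :
    legendreNat n x = ultraspherical (1 / 2) n x := by
  induction n using Nat.twoStepInduction with
  | zero => simp [legendreNat, ultraspherical]
  | one => simp [legendreNat, ultraspherical]
  | more n h1 h2 =>
    simp only [legendreNat, ultraspherical, h1, h2]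
    ring

theorem ultraspherical_add_two (lam : ℝ) (n : ℕ) (x : ℝ) :
    ((n : ℝ) + 2) * ultraspherical lam (n + 2) x =
      2 * ((n : ℝ) + 1 + lam) * x * ultraspherical lam (n + 1) x
        - ((n : ℝ) + 2 * lam) * ultraspherical lam n x := by
  rw [ultraspherical]
  field_simp

/-- The connection formula between the parameters `lam` and `lam + 1`. -/
theorem ultraspherical_connection {lam : ℝ} (h : ∀ n : ℕ, (n : ℝ) + lam ≠ 0) (x : ℝ) (n : ℕ) :
    ((n : ℝ) + 2 + lam) * ultraspherical lam (n + 2) x =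
      lam * (ultraspherical (lam + 1) (n + 2) x - ultraspherical (lam + 1) n x) := by
  have h' : ∀ n : ℕ, (n : ℝ) + 1 + lam ≠ 0 := fun n => by exact_mod_cast h (n + 1)
  have h'' : ∀ n : ℕ, (n : ℝ) + 2 + lam ≠ 0 := fun n => by exact_mod_cast h (n + 2)
  induction n using Nat.twoStepInduction with
  | zero =>
    simp only [ultraspherical]
    push_cast
    field_simp
    ring
  | one =>
    simp only [ultraspherical]
    push_cast
    field_simp
    ring
  | more n h1 h2 =>
    have u := ultraspherical_add_two lam (n + 2) x
    have t2 := ultraspherical_add_two (lam + 1) (n + 2) x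
    have t0 := ultraspherical_add_two (lam + 1) n x
    push_cast at u t2 t0 h2 ⊢
    have e2 := h'' n
    have e4 : (n : ℝ) + 4 ≠ 0 := by positivity
    generalize ultraspherical lam (n + 2 + 2) x = U4 at *
    generalize ultraspherical lam (n + 2 + 1) x = U3 at *
    generalize ultraspherical lam (n + 2) x = U2 at *
    generalize ultraspherical (lam + 1) (n + 2 + 2) x = T4 at *
    generalize ultraspherical (lam + 1) (n + 2 + 1) x = T3 at *
    generalize ultraspherical (lam + 1) (n + 2) x = T2 at *
    generalize ultraspherical (lam + 1) (n + 1) x = T1 at *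
    generalize ultraspherical (lam + 1) n x = T0 at *
    have h2' : ((n : ℝ) + 3 + lam) * U3 = lam * (T3 - T1) := by linear_combination h2
    -- The factor `n + 4` makes the recurrences usable; `n + 2 + lam` lets `h1` eliminate `U2`.
    apply mul_left_cancel₀ (mul_ne_zero e4 e2)
    linear_combination ((n : ℝ) + 2 + lam) * ((n : ℝ) + 4 + lam) * u
      + ((n : ℝ) + 2 + lam) * ((n : ℝ) + 4 + lam) * 2 * x * h2'
      - ((n : ℝ) + 4 + lam) * ((n : ℝ) + 2 + 2 * lam) * h1
      - lam * ((n : ℝ) + 2 + lam) * t2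
      + lam * ((n : ℝ) + 4 + lam) * t0

/-- Differentiate the three-term recurrence: the product rule leaves one undifferentiated
`C_{n+2}^{(lam)}`, which the connection formula rewrites with parameter `lam + 1`, where the
recurrence finishes. -/
theorem hasDerivAt_ultraspherical {lam : ℝ} (h : ∀ n : ℕ, (n : ℝ) + lam ≠ 0) (x : ℝ) (n : ℕ) :
    HasDerivAt (ultraspherical lam (n + 1)) (2 * lam * ultraspherical (lam + 1) n x) x := by
  induction n using Nat.twoStepInduction with
  | zero =>
    have hf : ultraspherical lam (0 + 1) = fun y => 2 * lam * id y := by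
      ext y; simp [ultraspherical]
    rw [hf]
    exact ((hasDerivAt_id x).const_mul (2 * lam)).congr_deriv (by simp [ultraspherical])
  | one =>
    have hf : ultraspherical lam (1 + 1) =
        fun y => (2 * lam * id y * (2 * (1 + lam) * id y) - 2 * lam) / 2 := by
      ext y; simp [ultraspherical]; ring
    rw [hf]
    refine (((((hasDerivAt_id x).const_mul (2 * lam)).fun_mul
      ((hasDerivAt_id x).const_mul (2 * (1 + lam)))).sub_const (2 * lam)).div_const 2).congr_deriv ?_
    simp [ultraspherical]; ring
  | more n h1 h2 =>
    have hf : ultraspherical lam (n + 2 + 1) = fun y =>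
        (2 * ((n : ℝ) + 2 + lam) * (id y * ultraspherical lam (n + 1 + 1) y)
          - ((n : ℝ) + 1 + 2 * lam) * ultraspherical lam (n + 1) y) / ((n : ℝ) + 3) := by
      ext y
      have u := ultraspherical_add_two lam (n + 1) y
      have e : (n : ℝ) + 3 ≠ 0 := by positivity
      push_cast at u
      rw [eq_div_iff e, id]
      linear_combination u
    rw [hf]
    refine ((((((hasDerivAt_id x).fun_mul h2).const_mul (2 * ((n : ℝ) + 2 + lam))).fun_sub
      (h1.const_mul ((n : ℝ) + 1 + 2 * lam))).div_const ((n : ℝ) + 3))).congr_deriv ?_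
    have c := ultraspherical_connection h x n
    have t := ultraspherical_add_two (lam + 1) n x
    have e : (n : ℝ) + 3 ≠ 0 := by positivity
    rw [div_eq_iff e, id]
    linear_combination 2 * c - 2 * lam * t

/-! ### Legendre polynomials, their iterated antiderivatives, and values at the endpoints. -/

theorem neg_half_ne (n : ℕ) : (n : ℝ) + -1 / 2 ≠ 0 := by
  intro h
  have h1 : (2 * n : ℝ) = 1 := by linarith
  have h2 : 2 * n = 1 := by exact_mod_cast h1
  omega

theorem neg_three_halves_ne (n : ℕ) : (n : ℝ) + -3 / 2 ≠ 0 := by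
  intro h
  have h1 : (2 * n : ℝ) = 3 := by linarith
  have h2 : 2 * n = 3 := by exact_mod_cast h1
  omega

/-- The antiderivative `(P_{k+1} - P_{k-1}) / (2k+1)` of the Legendre polynomial `P_k`. -/
noncomputable def legendreInt (k : ℕ) (x : ℝ) : ℝ := -ultraspherical (-1 / 2) (k + 1) x

/-- An antiderivative of `legendreInt k`. -/
noncomputable def legendreIntInt (k : ℕ) (x : ℝ) : ℝ := ultraspherical (-3 / 2) (k + 2) x / 3

theorem legendre_natCast (k : ℕ) (x : ℝ) : legendre k x = legendreNat k x := by
  simp [legendre]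

theorem hasDerivAt_legendreInt (k : ℕ) (x : ℝ) :
    HasDerivAt (legendreInt k) (legendre k x) x := by
  refine (hasDerivAt_ultraspherical neg_half_ne x k).fun_neg.congr_deriv ?_
  rw [legendre_natCast, legendreNat_eq_ultraspherical]
  norm_num

theorem hasDerivAt_legendreIntInt (k : ℕ) (x : ℝ) :
    HasDerivAt (legendreIntInt k) (legendreInt k x) x := by
  refine ((hasDerivAt_ultraspherical neg_three_halves_ne x (k + 1)).div_const 3).congr_deriv ?_
  rw [legendreInt]
  norm_num
  ring

/-- The connection formula from `-1/2` to `1/2`. It fixes the constant of integration; in particular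
`k = 0` gives `x`, in accordance with `P_{-1} = 0`. -/
theorem legendreInt_eq (k : ℕ) (x : ℝ) :
    legendreInt k x = (legendre ((k : ℤ) + 1) x - legendre ((k : ℤ) - 1) x) / (2 * k + 1) := by
  have e : (2 * (k : ℝ) + 1) ≠ 0 := by positivity
  rw [eq_div_iff e]
  cases k with
  | zero => simp [legendreInt, legendre, legendreNat, ultraspherical]; ring
  | succ k =>
    have h1 : (((k + 1 : ℕ) : ℤ) + 1) = ((k + 2 : ℕ) : ℤ) := by push_cast; ring
    have h2 : (((k + 1 : ℕ) : ℤ) - 1) = (k : ℤ) := by push_cast; ring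
    have c := ultraspherical_connection neg_half_ne x k
    rw [h1, h2, legendre_natCast, legendre_natCast, legendreNat_eq_ultraspherical,
      legendreNat_eq_ultraspherical, legendreInt]
    norm_num at c ⊢
    linear_combination (-2) * c

theorem mul_legendre (k : ℕ) (x : ℝ) :
    x * legendre k x = ((k + 1) * legendre ((k : ℤ) + 1) x + k * legendre ((k : ℤ) - 1) x)
      / (2 * k + 1) := by
  have e : (2 * (k : ℝ) + 1) ≠ 0 := by positivity
  rw [eq_div_iff e]
  cases k with
  | zero => simp [legendre, legendreNat]
  | succ k =>
    have h1 : (((k + 1 : ℕ) : ℤ) + 1) = ((k + 2 : ℕ) : ℤ) := by push_cast; ring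
    have h2 : (((k + 1 : ℕ) : ℤ) - 1) = (k : ℤ) := by push_cast; ring
    rw [h1, h2, legendre_natCast, legendre_natCast, legendre_natCast, legendreNat]
    have e : (k : ℝ) + 2 ≠ 0 := by positivity
    push_cast
    field_simp
    ring

theorem continuous_legendreNat (n : ℕ) : Continuous (legendreNat n) := by
  induction n using Nat.twoStepInduction with
  | zero => exact (continuous_const (y := (1 : ℝ))).congr fun x => by simp [legendreNat]
  | one => exact continuous_id.congr fun x => by simp [legendreNat]
  | more n h1 h2 =>
    have : Continuous fun x => ((2 * (n : ℝ) + 3) * x * legendreNat (n + 1) x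
      - ((n : ℝ) + 1) * legendreNat n x) / ((n : ℝ) + 2) := by fun_prop
    exact this.congr fun x => by simp [legendreNat]

theorem continuous_legendre (k : ℤ) : Continuous (legendre k) := by
  unfold legendre
  split_ifs
  · exact continuous_const
  · exact continuous_legendreNat _

theorem continuous_legendreInt (k : ℕ) : Continuous (legendreInt k) :=
  continuous_iff_continuousAt.2 fun x => (hasDerivAt_legendreInt k x).continuousAt

theorem legendreInt_zero (x : ℝ) : legendreInt 0 x = x := by
  simp [legendreInt, ultraspherical]; ring

theorem ultraspherical_neg_half_of_sq_eq_one {x : ℝ} (hx : x ^ 2 = 1) (n : ℕ) :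
    ultraspherical (-1 / 2) (n + 2) x = 0 := by
  induction n using Nat.twoStepInduction with
  | zero => simp only [ultraspherical]; push_cast; linear_combination (-1 / 2) * hx
  | one => simp only [ultraspherical]; push_cast; linear_combination (-x / 2) * hx
  | more n h1 h2 => rw [ultraspherical, h1, h2]; simp

/-- The polynomials of degree 4 and 5 are multiples of `(x² - 1)²`, and two consecutive zeros
propagate through the recurrence. -/
theorem ultraspherical_neg_three_halves_of_sq_eq_one {x : ℝ} (hx : x ^ 2 = 1) (n : ℕ) :
    ultraspherical (-3 / 2) (n + 4) x = 0 := by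
  induction n using Nat.twoStepInduction with
  | zero =>
    simp only [ultraspherical]; push_cast
    linear_combination (3 / 8 * (x ^ 2 - 1)) * hx
  | one =>
    simp only [ultraspherical]; push_cast
    linear_combination (3 / 8 * x * (x ^ 2 - 1)) * hx
  | more n h1 h2 => rw [ultraspherical, h1, h2]; simp

theorem legendreInt_succ_of_sq_eq_one {x : ℝ} (hx : x ^ 2 = 1) (k : ℕ) :
    legendreInt (k + 1) x = 0 := by
  rw [legendreInt, ultraspherical_neg_half_of_sq_eq_one hx, neg_zero]

theorem legendreIntInt_add_two_of_sq_eq_one {x : ℝ} (hx : x ^ 2 = 1) (k : ℕ) :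
    legendreIntInt (k + 2) x = 0 := by
  rw [legendreIntInt, ultraspherical_neg_three_halves_of_sq_eq_one hx, zero_div]

theorem legendreIntInt_one_right (k : ℕ) :
    legendreIntInt k 1 = delta k 0 - delta k 1 / 3 := by
  match k with
  | 0 => norm_num [legendreIntInt, ultraspherical, delta]
  | 1 => norm_num [legendreIntInt, ultraspherical, delta]
  | k + 2 => rw [legendreIntInt_add_two_of_sq_eq_one (by norm_num)]; simp [delta]

theorem integral_legendreInt (k : ℕ) : ∫ t in (-1 : ℝ)..1, legendreInt k t = -2 / 3 * delta k 1 := by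
  rw [intervalIntegral.integral_eq_sub_of_hasDerivAt
    (fun x _ => hasDerivAt_legendreIntInt k x) ((continuous_legendreInt k).intervalIntegrable _ _)]
  match k with
  | 0 => norm_num [legendreIntInt, ultraspherical, delta]
  | 1 => norm_num [legendreIntInt, ultraspherical, delta]
  | k + 2 =>
    rw [legendreIntInt_add_two_of_sq_eq_one (by norm_num),
      legendreIntInt_add_two_of_sq_eq_one (by norm_num)]
    simp [delta]

theorem legendreInt_one_right (k : ℕ) : legendreInt k 1 = delta k 0 := by
  cases k with
  | zero => simp [legendreInt_zero, delta]
  | succ k => rw [legendreInt_succ_of_sq_eq_one (by norm_num)]; simp [delta]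

theorem legendreInt_neg_one_right (k : ℕ) : legendreInt k (-1) = -delta k 0 := by
  cases k with
  | zero => simp [legendreInt_zero, delta]
  | succ k => rw [legendreInt_succ_of_sq_eq_one (by norm_num)]; simp [delta]

theorem integral_legendre (k : ℕ) : ∫ t in (-1 : ℝ)..1, legendre k t = 2 * delta k 0 := by
  rw [intervalIntegral.integral_eq_sub_of_hasDerivAt
    (fun x _ => hasDerivAt_legendreInt k x) ((continuous_legendre k).intervalIntegrable _ _),
    legendreInt_one_right, legendreInt_neg_one_right]
  ring

/-- The moment of a Legendre polynomial against the jump of `w log w` across its cut. -/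
theorem integral_sub_mul_legendre (k : ℕ) (x a : ℝ) :
    ∫ s in a..1, (x - s) * legendre k s =
      (x - 1) * legendreInt k 1 - (x - a) * legendreInt k a
        + (legendreIntInt k 1 - legendreIntInt k a) := by
  have h : ∀ s ∈ Set.uIcc a 1, HasDerivAt
      (fun s => (x - s) * legendreInt k s + legendreIntInt k s) ((x - s) * legendre k s) s := by
    intro s _
    refine ((((hasDerivAt_id s).const_sub x).fun_mul (hasDerivAt_legendreInt k s)).fun_add
      (hasDerivAt_legendreIntInt k s)).congr_deriv ?_
    simp
  rw [intervalIntegral.integral_eq_sub_of_hasDerivAt h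
    ((by have := continuous_legendre k; fun_prop : Continuous _).intervalIntegrable _ _)]
  ring

/-! ### The logarithm along segments: integrability and integration by parts. -/

open MeasureTheory Set Filter Topology

theorem norm_log_le (w : ℂ) : ‖Complex.log w‖ ≤ |Real.log ‖w‖| + Real.pi := by
  have h := Complex.norm_le_abs_re_add_abs_im (Complex.log w)
  rw [Complex.log_re, Complex.log_im] at h
  linarith [Complex.abs_arg_le_pi w]

/-- The function `w log w` is continuous at the origin and off the branch cut. -/
theorem continuousAt_mul_log_add (e : ℂ) {w : ℂ} (hw : w = 0 ∨ w ∈ Complex.slitPlane) :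
    ContinuousAt (fun w => w * (Complex.log w + e)) w := by
  rcases hw with rfl | hw
  · have h1 : Tendsto (fun w : ℂ => |‖w‖ * Real.log ‖w‖| + (Real.pi + ‖e‖) * ‖w‖) (𝓝 0) (𝓝 0) := by
      have hc : Continuous fun w : ℂ => |‖w‖ * Real.log ‖w‖| + (Real.pi + ‖e‖) * ‖w‖ := by
        have := Real.continuous_mul_log.comp (continuous_norm (E := ℂ))
        simp only [Function.comp_def] at this
        fun_prop
      simpa using hc.tendsto 0
    unfold ContinuousAt
    simp only [zero_mul]
    refine squeeze_zero_norm (fun w => ?_) h1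
    rw [norm_mul, abs_mul, abs_norm]
    have h2 : ‖Complex.log w + e‖ ≤ |Real.log ‖w‖| + Real.pi + ‖e‖ :=
      (norm_add_le _ _).trans (by linarith [norm_log_le w])
    nlinarith [mul_le_mul_of_nonneg_left h2 (norm_nonneg w)]
  · exact continuousAt_id.mul ((continuousAt_clog hw).add continuousAt_const)

/-- The imaginary part of the logarithm is bounded by `π`, and `log ‖·‖` of a meromorphic function
is integrable, even through a zero. -/
theorem intervalIntegrable_log_affine (a b : ℂ) (α β : ℝ) :
    IntervalIntegrable (fun t : ℝ => Complex.log (a - b * t)) volume α β := by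
  have h1 : IntervalIntegrable (fun t : ℝ => Real.log ‖a - b * t‖) volume α β := by
    apply MeromorphicOn.intervalIntegrable_log_norm
    intro t _
    have : AnalyticAt ℝ (fun t : ℝ => a - b * t) t :=
      analyticAt_const.sub (analyticAt_const.mul (Complex.ofRealCLM.analyticAt t))
    exact this.meromorphicAt
  have h2 : IntervalIntegrable (fun t : ℝ => |Real.log ‖a - b * t‖| + Real.pi) volume α β :=
    h1.abs.add intervalIntegrable_const
  refine h2.mono_fun' ?_ (ae_of_all _ fun t => norm_log_le _)
  exact (Complex.measurable_log.comp (by fun_prop)).aestronglyMeasurable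

theorem hasDerivAt_affine (a b : ℂ) (t : ℝ) : HasDerivAt (fun t : ℝ => a - b * t) (-b) t := by
  have := ((Complex.ofRealCLM.hasDerivAt (x := t)).const_mul b).const_sub a
  simpa using this

variable {p W : ℝ → ℝ}

theorem continuous_of_hasDerivAt (hW : ∀ x, HasDerivAt W (p x) x) : Continuous W :=
  continuous_iff_continuousAt.2 fun x => (hW x).continuousAt

theorem intervalIntegrable_affine_mul_log (a b : ℂ) (hp : Continuous p) (α β : ℝ) :
    IntervalIntegrable (fun t : ℝ => (a - b * t) * Complex.log (a - b * t) * (p t : ℂ))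
      volume α β := by
  have h := (intervalIntegrable_log_affine a b α β).mul_continuousOn
    (g := fun t : ℝ => (a - b * t) * (p t : ℂ)) (by fun_prop)
  exact h.congr fun t _ => by ring

theorem intervalIntegrable_log_affine_add_one_mul (a b : ℂ) (hp : Continuous p) (α β : ℝ) :
    IntervalIntegrable (fun t : ℝ => (Complex.log (a - b * t) + 1) * (p t : ℂ)) volume α β :=
  ((intervalIntegrable_log_affine a b α β).add intervalIntegrable_const).mul_continuousOn
    (by fun_prop)

/-- Integration by parts for `w log w` along a segment on which `log w` agrees with the branch
`log (c w) + e`. -/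
theorem integral_mul_log_of_branch {a b c e : ℂ} (hb : b ≠ 0) (hc : c ≠ 0) {α β : ℝ} (hle : α ≤ β)
    (hslit : ∀ t ∈ Icc α β, a - b * (t : ℂ) = 0 ∨ c * (a - b * (t : ℂ)) ∈ Complex.slitPlane)
    (hlog : ∀ t ∈ Ioo α β, a - b * (t : ℂ) ≠ 0 →
      Complex.log (a - b * t) = Complex.log (c * (a - b * t)) + e)
    (hp : Continuous p) (hW : ∀ x, HasDerivAt W (p x) x) :
    ∫ t in α..β, (a - b * t) * Complex.log (a - b * t) * (p t : ℂ) =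
      (a - b * β) * (Complex.log (c * (a - b * β)) + e) * (W β : ℂ)
        - (a - b * α) * (Complex.log (c * (a - b * α)) + e) * (W α : ℂ)
        + b * ∫ t in α..β, (Complex.log (a - b * t) + 1) * (W t : ℂ) := by
  have hWc := continuous_of_hasDerivAt hW
  have hI1 := intervalIntegrable_affine_mul_log a b hp α β
  have hI2 := intervalIntegrable_log_affine_add_one_mul a b hWc α β
  -- The path meets the singularity `w = 0` at most once; there only continuity of `w log w` is
  -- needed, not differentiability.
  have hs : ({t : ℝ | a - b * (t : ℂ) = 0}).Countable := by
    apply Set.Subsingleton.countable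
    intro t ht t' ht'
    have h1 : b * (t : ℂ) = b * t' := by
      rw [← sub_eq_zero.1 ht, ← sub_eq_zero.1 ht']
    exact_mod_cast mul_left_cancel₀ hb h1
  have key := integral_eq_of_hasDerivAt_off_countable_of_le
    (fun t : ℝ => (a - b * t) * (Complex.log (c * (a - b * t)) + e) * (W t : ℂ))
    (fun t : ℝ => (a - b * t) * Complex.log (a - b * t) * (p t : ℂ)
      - b * ((Complex.log (a - b * t) + 1) * (W t : ℂ))) hle hs ?_ ?_ (hI1.sub (hI2.const_mul b))
  · rw [intervalIntegral.integral_sub hI1 (hI2.const_mul b),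
      intervalIntegral.integral_const_mul] at key
    linear_combination key
  · intro t ht
    apply ContinuousAt.continuousWithinAt
    have h0 : c * (a - b * (t : ℂ)) = 0 ∨ c * (a - b * (t : ℂ)) ∈ Complex.slitPlane :=
      (hslit t ht).imp_left fun h => by rw [h, mul_zero]
    have h1 : ContinuousAt (fun t : ℝ => c * (a - b * (t : ℂ))) t := by fun_prop
    have h2 := ContinuousAt.comp (f := fun t : ℝ => c * (a - b * (t : ℂ)))
      (continuousAt_mul_log_add e h0) h1
    -- Continuity is known in the rotated variable `c w`; the factor `c⁻¹` undoes the rotation.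
    have h3 : ContinuousAt (fun t : ℝ => c⁻¹ * (c * (a - b * (t : ℂ))
        * (Complex.log (c * (a - b * t)) + e)) * (W t : ℂ)) t := by
      simp only [Function.comp_def] at h2
      have : ContinuousAt (fun t : ℝ => (W t : ℂ)) t := by fun_prop
      exact (continuousAt_const.mul h2).mul this
    refine h3.congr (Eventually.of_forall fun t => ?_)
    field_simp
  · rintro t ⟨ht, hne⟩
    have hne' : a - b * (t : ℂ) ≠ 0 := hne
    have hsl := (hslit t (Ioo_subset_Icc_self ht)).resolve_left hne'
    have hd := hasDerivAt_affine a b t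
    have hl := ((hd.const_mul c).clog_real hsl).add_const e
    refine ((hd.fun_mul hl).fun_mul (hW t).ofReal_comp).congr_deriv ?_
    rw [hlog t ht hne']
    field_simp
    ring

/-! ### Rotated branches of the logarithm; horizontal and vertical segments. -/

/-- Rotation by `-i` carries the closed upper half-plane, cut included, to the closed right
half-plane, so arguments in `[-π/2, π/2]` shift by `π/2` without wrapping. -/
theorem log_eq_log_neg_I_mul {w : ℂ} (hw : w ≠ 0) (h : 0 ≤ w.im) :
    Complex.log w = Complex.log (-Complex.I * w) + Real.pi / 2 * Complex.I := by
  have h1 : 0 ≤ (-Complex.I * w).re := by simpa using h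
  have h2 := abs_le.1 (Complex.abs_arg_le_pi_div_two_iff.2 h1)
  have h3 : Complex.log ((-Complex.I * w) * Complex.I) = _ :=
    (Complex.log_mul_eq_add_log_iff (by simpa using hw) Complex.I_ne_zero).2
      (by rw [Complex.arg_I]; constructor <;> linarith [Real.pi_pos])
  rw [Complex.log_I] at h3
  rw [← h3]
  congr 1
  linear_combination w * Complex.I_mul_I

theorem log_eq_log_neg_add {w : ℂ} (hr : w.re < 0) (h : 0 ≤ w.im) :
    Complex.log w = Complex.log (-w) + Real.pi * Complex.I := by
  have h1 : (-w).im ≤ 0 := by simpa using h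
  have h2 : 0 < (-w).re := by simpa using hr
  have h3 := abs_le.1 (Complex.abs_arg_le_pi_div_two_iff.2 h2.le)
  have h5 : Complex.arg (-w) ≤ 0 := by
    rcases h1.lt_or_eq with h1 | h1
    · exact (Complex.arg_neg_iff.2 h1).le
    · exact (Complex.arg_eq_zero_iff.2 ⟨h2.le, h1⟩).le
  have h4 : Complex.log ((-w) * (-1)) = _ :=
    (Complex.log_mul_eq_add_log_iff (by rintro h; simp [h] at h2) (by simp)).2
      (by rw [Complex.arg_neg_one]; constructor <;> linarith [Real.pi_pos])
  rw [Complex.log_neg_one] at h4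
  rw [← h4]
  simp

theorem log_eq_log_neg_sub {w : ℂ} (h : w.im < 0) :
    Complex.log w = Complex.log (-w) - Real.pi * Complex.I := by
  rw [Complex.log, Complex.log, Complex.arg_neg_eq_arg_add_pi_of_im_neg h, norm_neg]
  push_cast
  ring

/-- A horizontal segment stays in one half-plane. If it lies on the real axis, the principal value
is the limit from above, so the branch rotated by `-i` is continuous along it and no jump arises. -/
theorem integral_mul_log_sub_ofReal (z : ℂ) (hp : Continuous p)
    (hW : ∀ x, HasDerivAt W (p x) x) :
    ∫ s in (-1 : ℝ)..1, (z - s) * Complex.log (z - s) * (p s : ℂ) =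
      (z - 1) * Complex.log (z - 1) * (W 1 : ℂ) - (z + 1) * Complex.log (z + 1) * (W (-1) : ℂ)
        + ∫ s in (-1 : ℝ)..1, (Complex.log (z - s) + 1) * (W s : ℂ) := by
  rcases le_or_gt 0 z.im with h | h
  · have hlog : ∀ s : ℝ, z - s ≠ 0 →
        Complex.log (z - s) = Complex.log (-Complex.I * (z - s)) + Real.pi / 2 * Complex.I :=
      fun s hs => log_eq_log_neg_I_mul hs (by simpa using h)
    -- At `w = 0` the two branches differ, but the factor `w` kills the difference.
    have hend : ∀ s : ℝ, (z - s) * (Complex.log (-Complex.I * (z - s)) + Real.pi / 2 * Complex.I)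
        = (z - s) * Complex.log (z - s) := by
      intro s
      by_cases hs : z - s = 0
      · rw [hs]; simp
      · rw [hlog s hs]
    have := integral_mul_log_of_branch (a := z) (b := 1) (c := -Complex.I)
      (e := Real.pi / 2 * Complex.I) one_ne_zero (by simp) (α := -1) (β := 1) (by norm_num)
      (fun s _ => ?_) (fun s _ hs => by simpa only [one_mul] using hlog s (by simpa using hs)) hp hW
    · simp only [one_mul, hend] at this
      simpa using this
    · by_cases hs : z - s = 0
      · left; simpa using hs
      · right
        rw [Complex.mem_slitPlane_iff]
        by_contra! hcon
        apply hs
        simp at hcon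
        apply Complex.ext <;> simp
        · linarith
        · linarith
  · have := integral_mul_log_of_branch (a := z) (b := 1) (c := 1) (e := 0) one_ne_zero one_ne_zero
      (α := -1) (β := 1) (by norm_num) (fun s _ => Or.inr ?_) (fun s _ hs => by simp) hp hW
    · simpa using this
    · rw [Complex.mem_slitPlane_iff]
      right
      simpa using h.ne

/-- For `Re z < 0` the segment meets the cut at `t = Im z`, where `w = Re z`. The logarithm is `log
(-w) + πi` for `t ≤ Im z` and `log (-w) - πi` beyond; the boundary terms of the two pieces at `t =
Im z` differ by the jump. -/
theorem integral_mul_log_sub_I_mul (z : ℂ) (hp : Continuous p)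
    (hW : ∀ x, HasDerivAt W (p x) x) :
    ∫ t in (-1 : ℝ)..1, (z - Complex.I * t) * Complex.log (z - Complex.I * t) * (p t : ℂ) =
      (z - Complex.I) * Complex.log (z - Complex.I) * (W 1 : ℂ)
        - (z + Complex.I) * Complex.log (z + Complex.I) * (W (-1) : ℂ)
        + Complex.I * (∫ t in (-1 : ℝ)..1, (Complex.log (z - Complex.I * t) + 1) * (W t : ℂ))
        + (if z.re < 0 ∧ -1 ≤ z.im ∧ z.im < 1 then
            2 * Complex.I * Real.pi * z.re * (W z.im : ℂ) else 0) := by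
  rcases le_or_gt 0 z.re with h | h
  · have := integral_mul_log_of_branch (a := z) (b := Complex.I) (c := 1) (e := 0) Complex.I_ne_zero
      one_ne_zero (α := -1) (β := 1) (by norm_num) (fun t _ => ?_) (fun s _ hs => by simp) hp hW
    · rw [if_neg (by intro h'; linarith [h'.1])]
      simpa using this
    · by_cases hs : z - Complex.I * t = 0
      · left; exact hs
      · right
        rw [Complex.mem_slitPlane_iff]
        by_contra! hcon
        apply hs
        simp at hcon
        apply Complex.ext <;> simp
        · linarith
        · linarith
  · have hsl : ∀ t : ℝ, (-1) * (z - Complex.I * t) ∈ Complex.slitPlane := fun t => by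
      rw [Complex.mem_slitPlane_iff]; left; simpa using h
    have hre : ∀ t : ℝ, (z - Complex.I * t).re < 0 := fun t => by simpa using h
    have hup : ∀ t : ℝ, t ≤ z.im →
        Complex.log (z - Complex.I * t) =
          Complex.log (-1 * (z - Complex.I * t)) + Real.pi * Complex.I := fun t ht => by
      rw [neg_one_mul]; exact log_eq_log_neg_add (hre t) (by simpa using ht)
    have hdown : ∀ t : ℝ, z.im < t →
        Complex.log (z - Complex.I * t) =
          Complex.log (-1 * (z - Complex.I * t)) + -(Real.pi * Complex.I) := fun t ht => by
      rw [neg_one_mul, ← sub_eq_add_neg]; exact log_eq_log_neg_sub (by simpa using ht)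
    have Iup : ∀ α β : ℝ, α ≤ β → β ≤ z.im → _ := fun α β hle hβ =>
      integral_mul_log_of_branch (a := z) (b := Complex.I) (c := -1) (e := Real.pi * Complex.I)
        Complex.I_ne_zero (by simp) hle (fun t _ => Or.inr (hsl t))
        (fun t ht _ => hup t (ht.2.le.trans hβ)) hp hW
    have Idown : ∀ α β : ℝ, α ≤ β → z.im ≤ α → _ := fun α β hle hα =>
      integral_mul_log_of_branch (a := z) (b := Complex.I) (c := -1) (e := -(Real.pi * Complex.I))
        Complex.I_ne_zero (by simp) hle (fun t _ => Or.inr (hsl t))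
        (fun t ht _ => hdown t (hα.trans_lt ht.1)) hp hW
    have u1 := hup 1
    have um := hup (-1)
    have d1 := hdown 1
    have dm := hdown (-1)
    have e1 : z - Complex.I * (1 : ℝ) = z - Complex.I := by simp
    have em : z - Complex.I * (-1 : ℝ) = z + Complex.I := by simp
    rcases le_or_gt 1 z.im with hy | hy
    · rw [if_neg (by intro h'; linarith [h'.2.2]), Iup _ _ (by norm_num) hy, ← u1 hy,
        ← um (by linarith), e1, em]
      simp
    rcases lt_or_ge z.im (-1) with hy' | hy'
    · rw [if_neg (by intro h'; linarith [h'.2.1]), Idown _ _ (by norm_num) hy'.le, ← d1 hy,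
        ← dm hy', e1, em]
      simp
    -- When `z.im = -1` the first piece is degenerate, yet the jump remains: the principal value at
    -- `z + i` is the upper limit while the integral uses the lower branch.
    · have hWc := continuous_of_hasDerivAt hW
      have hI2 := intervalIntegrable_log_affine_add_one_mul z Complex.I hWc
      rw [if_pos ⟨h, hy', hy⟩, ← intervalIntegral.integral_add_adjacent_intervals
          (intervalIntegrable_affine_mul_log z Complex.I hp (-1) z.im)
          (intervalIntegrable_affine_mul_log z Complex.I hp z.im 1),
        ← intervalIntegral.integral_add_adjacent_intervals (hI2 (-1) z.im) (hI2 z.im 1),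
        Iup _ _ hy' le_rfl, Idown _ _ hy.le le_rfl, ← d1 hy, ← um hy', e1, em]
      have er : z - Complex.I * z.im = z.re := by
        linear_combination (-1 : ℂ) * Complex.re_add_im z
      rw [er]
      ring

/-! ### Integrals over the square: integrability, Fubini, integration by parts. -/

theorem isCompact_square : IsCompact square := isCompact_Icc.prod isCompact_Icc

theorem integrableOn_square_of_continuous {F : ℝ × ℝ → ℂ} (hF : Continuous F) :
    IntegrableOn F square := hF.continuousOn.integrableOn_compact isCompact_square

theorem volume_restrict_square : (volume : Measure (ℝ × ℝ)).restrict square =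
    (volume.restrict (Icc (-1) 1)).prod (volume.restrict (Icc (-1) 1)) := by
  rw [square, Measure.volume_eq_prod, Measure.prod_restrict]

theorem intervalIntegral_eq_Icc (f : ℝ → ℂ) :
    ∫ t in (-1 : ℝ)..1, f t = ∫ t in Icc (-1 : ℝ) 1, f t := by
  rw [intervalIntegral.integral_of_le (by norm_num), integral_Icc_eq_integral_Ioc]

theorem integral_square_eq {F : ℝ × ℝ → ℂ} (hF : IntegrableOn F square) :
    ∫ q in square, F q = ∫ s in (-1 : ℝ)..1, ∫ t in (-1 : ℝ)..1, F (s, t) := by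
  simp only [intervalIntegral_eq_Icc]
  rw [IntegrableOn, volume_restrict_square] at hF
  rw [volume_restrict_square, integral_prod _ hF]

theorem integral_square_eq_symm {F : ℝ × ℝ → ℂ} (hF : IntegrableOn F square) :
    ∫ q in square, F q = ∫ t in (-1 : ℝ)..1, ∫ s in (-1 : ℝ)..1, F (s, t) := by
  simp only [intervalIntegral_eq_Icc]
  rw [IntegrableOn, volume_restrict_square] at hF
  rw [volume_restrict_square, integral_prod_symm _ hF]

/-- The logarithmic kernel is integrable on the square, also when `z` lies on it. -/
theorem integrableOn_log_square (z : ℂ) :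
    IntegrableOn (fun q : ℝ × ℝ => Complex.log (z - ((q.1 : ℂ) + Complex.I * (q.2 : ℂ))))
      square := by
  have h1 : Integrable (fun s : ℝ => ‖Complex.log ((z.re : ℂ) - 1 * s)‖)
      (volume.restrict (Icc (-1 : ℝ) 1)) :=
    ((intervalIntegrable_iff_integrableOn_Icc_of_le (by norm_num)).1
      (intervalIntegrable_log_affine (z.re : ℂ) 1 (-1) 1)).norm
  have h2 : IntegrableOn (fun q : ℝ × ℝ => ‖Complex.log ((z.re : ℂ) - 1 * (q.1 : ℂ))‖) square := by
    rw [IntegrableOn, volume_restrict_square]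
    exact h1.comp_fst _
  have h3 : IntegrableOn (fun q : ℝ × ℝ => ‖z - ((q.1 : ℂ) + Complex.I * (q.2 : ℂ))‖ + Real.pi)
      square :=
    (by fun_prop : Continuous fun q : ℝ × ℝ =>
      ‖z - ((q.1 : ℂ) + Complex.I * (q.2 : ℂ))‖ + Real.pi).continuousOn.integrableOn_compact
      isCompact_square
  have hne : ∀ᵐ q : ℝ × ℝ ∂(volume.restrict square), q.1 ≠ z.re := by
    rw [volume_restrict_square]
    exact Measure.quasiMeasurePreserving_fst.ae (ae_restrict_of_ae (Measure.ae_ne volume z.re))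
  refine (h2.add h3).mono' ?_ ?_
  · exact (Complex.measurable_log.comp (by fun_prop)).aestronglyMeasurable
  · filter_upwards [hne] with q hq
    refine (norm_log_le _).trans ?_
    simp only [Pi.add_apply]
    set w := z - ((q.1 : ℂ) + Complex.I * (q.2 : ℂ)) with hw
    have hre : w.re = z.re - q.1 := by simp [hw]
    have hpos : 0 < |w.re| := abs_pos.2 (by rw [hre]; exact sub_ne_zero.2 hq.symm)
    have hle : |w.re| ≤ ‖w‖ := Complex.abs_re_le_norm w
    have hlog : |Real.log (|w.re|)| ≤ ‖Complex.log ((z.re : ℂ) - 1 * (q.1 : ℂ))‖ := by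
      rw [one_mul, ← Complex.ofReal_sub, ← hre]
      have := Complex.abs_re_le_norm (Complex.log (w.re : ℂ))
      rwa [Complex.log_re, Complex.norm_real, Real.norm_eq_abs] at this
    -- For `‖w‖ ≤ 1` the bound comes from `|Re w| ≤ ‖w‖`, for `‖w‖ ≥ 1` from `log r ≤ r`; the
    -- majorant `|log |Re w||` depends on one variable only.
    have hmain : |Real.log ‖w‖| ≤ |Real.log (|w.re|)| + ‖w‖ := by
      rcases le_total ‖w‖ 1 with h | h
      · rw [abs_of_nonpos (Real.log_nonpos (norm_nonneg _) h)]
        have := Real.log_le_log hpos hle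
        have := neg_abs_le (Real.log (|w.re|))
        linarith [norm_nonneg w]
      · rw [abs_of_nonneg (Real.log_nonneg h)]
        have := Real.log_le_self (norm_nonneg w)
        linarith [abs_nonneg (Real.log |w.re|)]
    linarith

theorem integrableOn_log_mul_square (z : ℂ) {F : ℝ × ℝ → ℂ} (hF : Continuous F) :
    IntegrableOn (fun q : ℝ × ℝ => Complex.log (z - ((q.1 : ℂ) + Complex.I * (q.2 : ℂ))) * F q)
      square :=
  (integrableOn_log_square z).mul_continuousOn hF.continuousOn isCompact_square

theorem logSquare_linear (z : ℂ) {f g : ℝ → ℝ → ℝ} (hf : Continuous fun q : ℝ × ℝ => f q.1 q.2)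
    (hg : Continuous fun q : ℝ × ℝ => g q.1 q.2) (a b : ℝ) :
    logSquare (fun s t => a * f s t + b * g s t) z = a * logSquare f z + b * logSquare g z := by
  unfold logSquare
  rw [← integral_const_mul, ← integral_const_mul, ← integral_add]
  · congr 1; ext q; push_cast; ring
  · exact (integrableOn_log_mul_square z (F := fun q => (f q.1 q.2 : ℂ)) (by fun_prop)).const_mul _
  · exact (integrableOn_log_mul_square z (F := fun q => (g q.1 q.2 : ℂ)) (by fun_prop)).const_mul _

/-- `∬_Ω w log w f(s,t) ds dt` with `w = z - (s + i t)`. -/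
noncomputable def mulLogSquare (f : ℝ → ℝ → ℝ) (z : ℂ) : ℂ :=
  ∫ q in square, (z - ((q.1 : ℂ) + Complex.I * (q.2 : ℂ))) *
    Complex.log (z - ((q.1 : ℂ) + Complex.I * (q.2 : ℂ))) * (f q.1 q.2 : ℂ)

theorem integrableOn_mul_log_square (z : ℂ) {f : ℝ → ℝ → ℝ}
    (hf : Continuous fun q : ℝ × ℝ => f q.1 q.2) :
    IntegrableOn (fun q : ℝ × ℝ => (z - ((q.1 : ℂ) + Complex.I * (q.2 : ℂ))) *
      Complex.log (z - ((q.1 : ℂ) + Complex.I * (q.2 : ℂ))) * (f q.1 q.2 : ℂ)) square := by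
  refine (integrableOn_log_mul_square z (F := fun q =>
    (z - ((q.1 : ℂ) + Complex.I * (q.2 : ℂ))) * (f q.1 q.2 : ℂ)) (by fun_prop)).congr
    (ae_of_all _ fun q => ?_)
  ring

theorem mul_logSquare (z : ℂ) {f : ℝ → ℝ → ℝ} (hf : Continuous fun q : ℝ × ℝ => f q.1 q.2) :
    z * logSquare f z = mulLogSquare f z + logSquare (fun s t => s * f s t) z
      + Complex.I * logSquare (fun s t => t * f s t) z := by
  unfold logSquare mulLogSquare
  have h1 := integrableOn_log_mul_square z (F := fun q => ((q.1 * f q.1 q.2 : ℝ) : ℂ)) (by fun_prop)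
  have h2 := integrableOn_log_mul_square z (F := fun q => ((q.2 * f q.1 q.2 : ℝ) : ℂ)) (by fun_prop)
  have h3 := integral_add (integrableOn_mul_log_square z hf) h1
  have h4 := integral_add ((integrableOn_mul_log_square z hf).add h1) (h2.const_mul Complex.I)
  simp only [Pi.add_apply] at h4
  rw [h3, integral_const_mul] at h4
  rw [← integral_const_mul, ← h4]
  congr 1; ext q; push_cast; ring

theorem integrableOn_log_add_one_mul_square (z : ℂ) {f : ℝ → ℝ → ℝ}
    (hf : Continuous fun q : ℝ × ℝ => f q.1 q.2) :
    IntegrableOn (fun q : ℝ × ℝ => (Complex.log (z - ((q.1 : ℂ) + Complex.I * (q.2 : ℂ))) + 1) *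
      (f q.1 q.2 : ℂ)) square := by
  refine ((integrableOn_log_mul_square z (F := fun q => (f q.1 q.2 : ℂ)) (by fun_prop)).add
    (integrableOn_square_of_continuous (F := fun q => (f q.1 q.2 : ℂ)) (by fun_prop))).congr
    (ae_of_all _ fun q => ?_)
  simp only [Pi.add_apply]
  ring

theorem integral_log_add_one_mul_square (z : ℂ) {p q : ℝ → ℝ} (hp : Continuous p)
    (hq : Continuous q) :
    ∫ r in square, (Complex.log (z - ((r.1 : ℂ) + Complex.I * (r.2 : ℂ))) + 1) *
      ((p r.1 * q r.2 : ℝ) : ℂ) = logSquare (fun s t => p s * q t) z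
        + ((∫ s in (-1 : ℝ)..1, p s : ℝ) : ℂ) * ((∫ t in (-1 : ℝ)..1, q t : ℝ) : ℂ) := by
  have h1 := integrableOn_log_mul_square z (F := fun r => ((p r.1 * q r.2 : ℝ) : ℂ)) (by fun_prop)
  have h2 := integrableOn_square_of_continuous (F := fun r => ((p r.1 * q r.2 : ℝ) : ℂ))
    (by fun_prop)
  have h3 : ∫ r in square, ((p r.1 * q r.2 : ℝ) : ℂ) =
      ((∫ s in (-1 : ℝ)..1, p s : ℝ) : ℂ) * ((∫ t in (-1 : ℝ)..1, q t : ℝ) : ℂ) := by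
    rw [integral_square_eq h2]
    push_cast
    rw [← intervalIntegral.integral_ofReal, ← intervalIntegral.integral_ofReal,
      ← intervalIntegral.integral_mul_const]
    simp only [intervalIntegral.integral_const_mul]
  rw [← h3, logSquare, ← integral_add h1 h2]
  congr 1; ext r; ring

variable {q V : ℝ → ℝ}

/-- Fubini is applied to the difference of the two integrands, whose inner integral over `s` is
exactly the boundary term on the vertical sides. The product of means comes from the `1` in `log w +
1`. -/
theorem mulLogSquare_eq_of_hasDerivAt_left (z : ℂ) (hp : Continuous p)
    (hW : ∀ x, HasDerivAt W (p x) x) (hq : Continuous q) :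
    mulLogSquare (fun s t => p s * q t) z = logSquare (fun s t => W s * q t) z
      + ((∫ s in (-1 : ℝ)..1, W s : ℝ) : ℂ) * ((∫ t in (-1 : ℝ)..1, q t : ℝ) : ℂ)
      + (W 1 * (∫ t in (-1 : ℝ)..1, (z - 1 - Complex.I * t) * Complex.log (z - 1 - Complex.I * t)
          * (q t : ℂ))
        - W (-1) * ∫ t in (-1 : ℝ)..1, (z + 1 - Complex.I * t) *
          Complex.log (z + 1 - Complex.I * t) * (q t : ℂ)) := by
  have hWc := continuous_of_hasDerivAt hW
  have h1 := integrableOn_mul_log_square z (f := fun s t => p s * q t) (by fun_prop)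
  have h2 := integrableOn_log_add_one_mul_square z (f := fun s t => W s * q t) (by fun_prop)
  have h3 := integral_sub h1 h2
  rw [integral_log_add_one_mul_square z hWc hq] at h3
  have h5 := integral_square_eq_symm (h1.sub h2)
  simp only [Pi.sub_apply] at h5
  rw [h5] at h3
  have h4 : ∀ t : ℝ, (∫ s in (-1 : ℝ)..1, ((z - ((s : ℂ) + Complex.I * (t : ℂ))) *
      Complex.log (z - ((s : ℂ) + Complex.I * (t : ℂ))) * ((p s * q t : ℝ) : ℂ)
      - (Complex.log (z - ((s : ℂ) + Complex.I * (t : ℂ))) + 1) * ((W s * q t : ℝ) : ℂ))) =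
      W 1 * ((z - 1 - Complex.I * t) * Complex.log (z - 1 - Complex.I * t) * (q t : ℂ))
        - W (-1) * ((z + 1 - Complex.I * t) * Complex.log (z + 1 - Complex.I * t) * (q t : ℂ)) := by
    intro t
    have k1 := intervalIntegrable_affine_mul_log (z - Complex.I * t) 1 hp (-1) 1
    have k2 := intervalIntegrable_log_affine_add_one_mul (z - Complex.I * t) 1 hWc (-1) 1
    have k3 := intervalIntegral.integral_sub k1 k2
    have k4 := integral_mul_log_sub_ofReal (z - Complex.I * t) hp hW
    simp only [one_mul] at k3
    rw [k4] at k3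
    have k5 : ∀ s : ℝ, (z - ((s : ℂ) + Complex.I * (t : ℂ))) *
      Complex.log (z - ((s : ℂ) + Complex.I * (t : ℂ))) * ((p s * q t : ℝ) : ℂ)
      - (Complex.log (z - ((s : ℂ) + Complex.I * (t : ℂ))) + 1) * ((W s * q t : ℝ) : ℂ) =
      (q t : ℂ) * ((z - Complex.I * t - s) * Complex.log (z - Complex.I * t - s) * (p s : ℂ)
        - (Complex.log (z - Complex.I * t - s) + 1) * (W s : ℂ)) := by
      intro s
      rw [show z - ((s : ℂ) + Complex.I * (t : ℂ)) = z - Complex.I * t - s by ring]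
      push_cast
      ring
    simp only [k5]
    rw [intervalIntegral.integral_const_mul, k3]
    rw [show z - Complex.I * t - 1 = z - 1 - Complex.I * t by ring,
      show z - Complex.I * t + 1 = z + 1 - Complex.I * t by ring]
    ring
  simp only [h4] at h3
  rw [intervalIntegral.integral_sub
      ((intervalIntegrable_affine_mul_log (z - 1) Complex.I hq (-1) 1).const_mul _)
      ((intervalIntegrable_affine_mul_log (z + 1) Complex.I hq (-1) 1).const_mul _),
    intervalIntegral.integral_const_mul, intervalIntegral.integral_const_mul] at h3
  rw [mulLogSquare]
  linear_combination -h3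

/-- As for the other variable, with the jump added: at fixed `s` it is weighted by `Re (z - s)` when
this is negative, that is by `min (z.re - s) 0`, a continuous function of `s`. -/
theorem mulLogSquare_eq_of_hasDerivAt_right (z : ℂ) (hp : Continuous p) (hq : Continuous q)
    (hV : ∀ x, HasDerivAt V (q x) x) :
    mulLogSquare (fun s t => p s * q t) z = Complex.I * (logSquare (fun s t => p s * V t) z
      + ((∫ s in (-1 : ℝ)..1, p s : ℝ) : ℂ) * ((∫ t in (-1 : ℝ)..1, V t : ℝ) : ℂ))
      + (V 1 * (∫ s in (-1 : ℝ)..1, (z - Complex.I - s) * Complex.log (z - Complex.I - s)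
          * (p s : ℂ))
        - V (-1) * ∫ s in (-1 : ℝ)..1, (z + Complex.I - s) *
          Complex.log (z + Complex.I - s) * (p s : ℂ))
      + (if -1 ≤ z.im ∧ z.im < 1 then 2 * Complex.I * Real.pi * (V z.im : ℂ) *
          ((∫ s in (-1 : ℝ)..1, min (z.re - s) 0 * p s : ℝ) : ℂ) else 0) := by
  have hVc := continuous_of_hasDerivAt hV
  have h1 := integrableOn_mul_log_square z (f := fun s t => p s * q t) (by fun_prop)
  have h2 := integrableOn_log_add_one_mul_square z (f := fun s t => p s * V t) (by fun_prop)
  have h3 := integral_sub h1 (h2.const_mul Complex.I)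
  rw [integral_const_mul, integral_log_add_one_mul_square z hp hVc] at h3
  have h5 := integral_square_eq (h1.sub (h2.const_mul Complex.I))
  simp only [Pi.sub_apply] at h5
  rw [h5] at h3
  have h4 : ∀ s : ℝ, (∫ t in (-1 : ℝ)..1, ((z - ((s : ℂ) + Complex.I * (t : ℂ))) *
      Complex.log (z - ((s : ℂ) + Complex.I * (t : ℂ))) * ((p s * q t : ℝ) : ℂ)
      - Complex.I * ((Complex.log (z - ((s : ℂ) + Complex.I * (t : ℂ))) + 1)
        * ((p s * V t : ℝ) : ℂ)))) =
      V 1 * ((z - Complex.I - s) * Complex.log (z - Complex.I - s) * (p s : ℂ))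
        - V (-1) * ((z + Complex.I - s) * Complex.log (z + Complex.I - s) * (p s : ℂ))
        + (if -1 ≤ z.im ∧ z.im < 1 then 2 * Complex.I * Real.pi * (V z.im : ℂ) else 0)
          * ((min (z.re - s) 0 * p s : ℝ) : ℂ) := by
    intro s
    have k1 := intervalIntegrable_affine_mul_log (z - s) Complex.I hq (-1) 1
    have k2 := intervalIntegrable_log_affine_add_one_mul (z - s) Complex.I hVc (-1) 1
    have k3 := intervalIntegral.integral_sub k1 (k2.const_mul Complex.I)
    have k4 := integral_mul_log_sub_I_mul (z - s) hq hV
    rw [k4, intervalIntegral.integral_const_mul] at k3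
    have k5 : ∀ t : ℝ, (z - ((s : ℂ) + Complex.I * (t : ℂ))) *
      Complex.log (z - ((s : ℂ) + Complex.I * (t : ℂ))) * ((p s * q t : ℝ) : ℂ)
      - Complex.I * ((Complex.log (z - ((s : ℂ) + Complex.I * (t : ℂ))) + 1)
        * ((p s * V t : ℝ) : ℂ)) =
      (p s : ℂ) * ((z - s - Complex.I * t) * Complex.log (z - s - Complex.I * t) * (q t : ℂ)
        - Complex.I * ((Complex.log (z - s - Complex.I * t) + 1) * (V t : ℂ))) := by
      intro t
      rw [show z - ((s : ℂ) + Complex.I * (t : ℂ)) = z - s - Complex.I * t by ring]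
      push_cast
      ring
    have k6 : (if (z - s).re < 0 ∧ -1 ≤ (z - s).im ∧ (z - s).im < 1 then
            2 * Complex.I * Real.pi * ((z - s).re : ℂ) * (V (z - s).im : ℂ) else 0) =
        (if -1 ≤ z.im ∧ z.im < 1 then 2 * Complex.I * Real.pi * (V z.im : ℂ) else 0)
          * ((min (z.re - s) 0 : ℝ) : ℂ) := by
      simp only [Complex.sub_re, Complex.sub_im, Complex.ofReal_re, Complex.ofReal_im, sub_zero]
      rcases lt_or_ge (z.re - s) 0 with h | h
      · rw [min_eq_left h.le]
        simp only [h, true_and]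
        split_ifs <;> ring
      · rw [min_eq_right h, if_neg (by intro h'; linarith [h'.1])]
        simp
    simp only [k5]
    rw [intervalIntegral.integral_const_mul, k3, k6]
    rw [show z - s - Complex.I = z - Complex.I - s by ring,
      show z - s + Complex.I = z + Complex.I - s by ring]
    push_cast
    ring
  simp only [h4] at h3
  have m1 := intervalIntegrable_affine_mul_log (z - Complex.I) 1 hp (-1) 1
  have m2 := intervalIntegrable_affine_mul_log (z + Complex.I) 1 hp (-1) 1
  simp only [one_mul] at m1 m2
  have m3 : IntervalIntegrable (fun s : ℝ => ((min (z.re - s) 0 * p s : ℝ) : ℂ)) volume (-1) 1 :=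
    (by fun_prop : Continuous fun s : ℝ =>
      ((min (z.re - s) 0 * p s : ℝ) : ℂ)).intervalIntegrable _ _
  rw [intervalIntegral.integral_add ((m1.const_mul _).sub (m2.const_mul _)) (m3.const_mul _),
    intervalIntegral.integral_sub (m1.const_mul _) (m2.const_mul _),
    intervalIntegral.integral_const_mul, intervalIntegral.integral_const_mul,
    intervalIntegral.integral_const_mul, intervalIntegral.integral_ofReal] at h3
  rw [← zero_mul (((∫ s in (-1 : ℝ)..1, min (z.re - s) 0 * p s : ℝ) : ℂ)), ← ite_mul, mulLogSquare]
  linear_combination -h3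

/-! ### Evaluating the boundary and jump terms for Legendre weights. -/

/-- The three-term recurrence of `L_k`, before the factor `z` is separated. -/
theorem integral_mul_log_mul_legendre (k : ℕ) (z : ℂ) :
    ∫ s in (-1 : ℝ)..1, (z - s) * Complex.log (z - s) * (legendre k s : ℂ) =
      (L1 ((k : ℤ) + 1) z - L1 ((k : ℤ) - 1) z) / (2 * (k : ℂ) + 1) + lambda k z := by
  have hP := fun k => continuous_legendre k
  have hW := continuous_legendreInt k
  have i : ∀ {f : ℝ → ℝ}, Continuous f → IntervalIntegrable
      (fun s : ℝ => Complex.log (z - s) * (f s : ℂ)) volume (-1) 1 := fun {f} hf => by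
    simpa only [one_mul] using (intervalIntegrable_log_affine z 1 (-1) 1).mul_continuousOn
      (g := fun s : ℝ => (f s : ℂ)) (by fun_prop)
  have h1 : ∫ s in (-1 : ℝ)..1, (Complex.log (z - s) + 1) * (legendreInt k s : ℂ) =
      (L1 ((k : ℤ) + 1) z - L1 ((k : ℤ) - 1) z) / (2 * (k : ℂ) + 1)
        + ((∫ s in (-1 : ℝ)..1, legendreInt k s : ℝ) : ℂ) := by
    have i3 : IntervalIntegrable (fun s : ℝ => (legendreInt k s : ℂ)) volume (-1) 1 :=
      (by fun_prop : Continuous fun s : ℝ => (legendreInt k s : ℂ)).intervalIntegrable _ _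
    rw [L1, L1, logInterval, logInterval, ← intervalIntegral.integral_sub (i (hP _)) (i (hP _)),
      ← intervalIntegral.integral_div, ← intervalIntegral.integral_ofReal,
      ← intervalIntegral.integral_add (((i (hP _)).sub (i (hP _))).div_const _) i3]
    congr 1; ext s
    rw [legendreInt_eq]
    push_cast
    ring
  rw [integral_mul_log_sub_ofReal z (hP k) (hasDerivAt_legendreInt k), h1, integral_legendreInt,
    legendreInt_one_right, legendreInt_neg_one_right, lambda]
  match k with
  | 0 => simp [delta]; ring
  | 1 => simp [delta]
  | k + 2 => simp [delta]

/-- The three-term recurrence of `M_k`, before the factor `z` is separated. -/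
theorem integral_mul_log_I_mul_legendre (k : ℕ) (z : ℂ) :
    ∫ t in (-1 : ℝ)..1, (z - Complex.I * t) * Complex.log (z - Complex.I * t) * (legendre k t : ℂ) =
      Complex.I * (M1 ((k : ℤ) + 1) z - M1 ((k : ℤ) - 1) z) / (2 * (k : ℂ) + 1) + mu k z := by
  have hP := fun k => continuous_legendre k
  have hW := continuous_legendreInt k
  have i : ∀ {f : ℝ → ℝ}, Continuous f → IntervalIntegrable
      (fun t : ℝ => Complex.log (z - Complex.I * t) * (f t : ℂ)) volume (-1) 1 := fun {f} hf =>
    (intervalIntegrable_log_affine z Complex.I (-1) 1).mul_continuousOn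
      (g := fun s : ℝ => (f s : ℂ)) (by fun_prop)
  have h1 : ∫ t in (-1 : ℝ)..1, (Complex.log (z - Complex.I * t) + 1) * (legendreInt k t : ℂ) =
      (M1 ((k : ℤ) + 1) z - M1 ((k : ℤ) - 1) z) / (2 * (k : ℂ) + 1)
        + ((∫ s in (-1 : ℝ)..1, legendreInt k s : ℝ) : ℂ) := by
    have i3 : IntervalIntegrable (fun s : ℝ => (legendreInt k s : ℂ)) volume (-1) 1 :=
      (by fun_prop : Continuous fun s : ℝ => (legendreInt k s : ℂ)).intervalIntegrable _ _
    rw [M1, M1, logIntervalI, logIntervalI,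
      ← intervalIntegral.integral_sub (i (hP _)) (i (hP _)),
      ← intervalIntegral.integral_div, ← intervalIntegral.integral_ofReal,
      ← intervalIntegral.integral_add (((i (hP _)).sub (i (hP _))).div_const _) i3]
    congr 1; ext s
    rw [legendreInt_eq]
    push_cast
    ring
  rw [integral_mul_log_sub_I_mul z (hP k) (hasDerivAt_legendreInt k), h1, integral_legendreInt,
    legendreInt_one_right, legendreInt_neg_one_right, mu]
  -- At this endpoint the jump `2πi x W(-1)` is present but `mu` omits it. Replacing `log` by
  -- `logMinus` at `z + i = x` accounts for it: both sides change by `-2πi x` for `k = 0` and by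
  -- nothing for `k ≥ 1`.
  by_cases hy : z.im = -1 ∧ z.re < 0
  · have e : z + Complex.I = z.re := by
      apply Complex.ext <;> simp [hy.1]
    have hlog : logMinus (z + Complex.I) =
        Complex.log (z + Complex.I) - 2 * Complex.I * Real.pi := by
      have : Complex.log (z + Complex.I) = Real.log ‖z + Complex.I‖ + Real.pi * Complex.I := by
        rw [e, Complex.log, Complex.arg_ofReal_of_neg hy.2]
      rw [logMinus, if_pos (by simp [hy.1, hy.2]), this]
      ring
    rw [if_pos (by simp [hy.1, hy.2]), if_neg (c := z.re < 0 ∧ -1 < z.im ∧ z.im < 1)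
      (by simp [hy.1]), hlog, hy.1, legendreInt_neg_one_right]
    match k with
    | 0 => simp [delta]; rw [← e]; ring
    | 1 => simp [delta]; ring
    | k + 2 => simp [delta]; ring
  · have hlog : logMinus (z + Complex.I) = Complex.log (z + Complex.I) := by
      rw [logMinus, if_neg]
      rintro ⟨h1, h2⟩
      exact hy ⟨by simp at h1; linarith, by simpa using h2⟩
    have hiff : (z.re < 0 ∧ -1 ≤ z.im ∧ z.im < 1) ↔ (z.re < 0 ∧ -1 < z.im ∧ z.im < 1) := by
      constructor
      · rintro ⟨h1, h2, h3⟩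
        exact ⟨h1, lt_of_le_of_ne h2 fun h => hy ⟨h.symm, h1⟩, h3⟩
      · rintro ⟨h1, h2, h3⟩
        exact ⟨h1, h2.le, h3⟩
    rw [hlog, legendreInt, if_congr hiff rfl rfl]
    clear hy hlog hiff h1 hW i
    match k with
    | 0 => simp [delta]; split_ifs <;> ring
    | 1 => simp [delta]; split_ifs <;> ring
    | k + 2 => simp [delta]; split_ifs <;> ring

theorem integral_min_mul_legendre (k : ℕ) (x : ℝ) :
    ∫ s in (-1 : ℝ)..1, min (x - s) 0 * legendre k s =
      -(if -1 ≤ x ∧ x ≤ 1 then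
        ultraspherical (-3 / 2) (k + 2) x / 3 - delta k 0 * x + delta k 1 / 3
      else if x < -1 then -2 * x * delta k 0 + 2 * delta k 1 / 3
      else 0) := by
  have hc := continuous_legendre k
  rcases lt_or_ge x (-1) with h | h
  · have e : ∫ s in (-1 : ℝ)..1, min (x - s) 0 * legendre k s =
        ∫ s in (-1 : ℝ)..1, (x - s) * legendre k s := by
      refine intervalIntegral.integral_congr fun s hs => ?_
      rw [uIcc_of_le (by norm_num)] at hs
      rw [min_eq_left (by linarith [hs.1])]
    have e2 := intervalIntegral.integral_eq_sub_of_hasDerivAt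
      (fun y (_ : y ∈ uIcc (-1 : ℝ) 1) => hasDerivAt_legendreIntInt k y)
      ((continuous_legendreInt k).intervalIntegrable _ _)
    rw [integral_legendreInt] at e2
    rw [e, integral_sub_mul_legendre, ← e2, legendreInt_one_right, legendreInt_neg_one_right,
      if_neg (by intro h'; linarith [h'.1]), if_pos h]
    ring
  rcases lt_or_ge 1 x with h' | h'
  · have e : ∫ s in (-1 : ℝ)..1, min (x - s) 0 * legendre k s = ∫ s in (-1 : ℝ)..1, (0 : ℝ) := by
      refine intervalIntegral.integral_congr fun s hs => ?_
      rw [uIcc_of_le (by norm_num)] at hs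
      rw [min_eq_right (by linarith [hs.2]), zero_mul]
    rw [e, if_neg (by intro h''; linarith [h''.2]), if_neg (by linarith)]
    simp
  · have hi : ∀ a b : ℝ, IntervalIntegrable (fun s => min (x - s) 0 * legendre k s) volume a b :=
      fun a b => (by fun_prop : Continuous _).intervalIntegrable _ _
    have e1 : ∫ s in (-1 : ℝ)..x, min (x - s) 0 * legendre k s = ∫ s in (-1 : ℝ)..x, (0 : ℝ) := by
      refine intervalIntegral.integral_congr fun s hs => ?_
      rw [uIcc_of_le h] at hs
      rw [min_eq_right (by linarith [hs.2]), zero_mul]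
    have e2 : ∫ s in x..1, min (x - s) 0 * legendre k s = ∫ s in x..1, (x - s) * legendre k s := by
      refine intervalIntegral.integral_congr fun s hs => ?_
      rw [uIcc_of_le h'] at hs
      rw [min_eq_left (by linarith [hs.1])]
    rw [← intervalIntegral.integral_add_adjacent_intervals (hi (-1) x) (hi x 1), e1, e2,
      integral_sub_mul_legendre, if_pos ⟨h, h'⟩, legendreInt_one_right, legendreIntInt_one_right,
      legendreIntInt]
    simp
    ring

/-- Identifies `beta` as the total jump collected by the vertical segments to the right of `z`. -/
theorem beta_eq (k j : ℕ) (z : ℂ) :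
    beta k j z = if -1 ≤ z.im ∧ z.im < 1 then 2 * Complex.I * Real.pi * (legendreInt j z.im : ℂ) *
      ((∫ s in (-1 : ℝ)..1, min (z.re - s) 0 * legendre k s : ℝ) : ℂ) else 0 := by
  rw [integral_min_mul_legendre, beta, legendreInt]
  by_cases h : -1 ≤ z.im ∧ z.im < 1
  · simp only [h, and_true]
    push_cast
    ring
  · simp only [h, and_false, if_false]
    simp

theorem integral_legendreInt_mul (k j : ℕ) :
    ((∫ s in (-1 : ℝ)..1, legendreInt k s : ℝ) : ℂ) * ((∫ t in (-1 : ℝ)..1, legendre j t : ℝ) : ℂ) =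
      if k = 1 ∧ j = 0 then -4 / 3 else 0 := by
  rw [integral_legendreInt, integral_legendre, delta, delta]
  split_ifs <;> simp_all
  norm_num

theorem mulLogSquare_legendre_left (k j : ℕ) (z : ℂ) :
    mulLogSquare (fun s t => legendre k s * legendre j t) z =
      logSquare (fun s t => legendreInt k s * legendre j t) z + F1 k j z := by
  rw [mulLogSquare_eq_of_hasDerivAt_left z (continuous_legendre k) (hasDerivAt_legendreInt k)
    (continuous_legendre j), integral_legendreInt_mul, integral_mul_log_I_mul_legendre,
    integral_mul_log_I_mul_legendre, legendreInt_one_right, legendreInt_neg_one_right, F1]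
  by_cases hk : k = 0
  · subst hk; simp [delta]; ring
  · simp [delta, hk]

theorem mulLogSquare_legendre_right (k j : ℕ) (z : ℂ) :
    mulLogSquare (fun s t => legendre k s * legendre j t) z =
      Complex.I * logSquare (fun s t => legendre k s * legendreInt j t) z + F2 k j z := by
  rw [mulLogSquare_eq_of_hasDerivAt_right z (continuous_legendre k) (continuous_legendre j)
    (hasDerivAt_legendreInt j), mul_comm ((∫ s in (-1 : ℝ)..1, legendre k s : ℝ) : ℂ),
    integral_legendreInt_mul, integral_mul_log_mul_legendre,
    integral_mul_log_mul_legendre, legendreInt_one_right, legendreInt_neg_one_right, ← beta_eq, F2]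
  match j with
  | 0 => simp [delta]; ring
  | 1 => by_cases hk : k = 0 <;> simp [delta, hk]; ring
  | j + 2 => simp [delta]

/-! ### Expansion in neighbouring `L2` and the final elimination. -/

theorem continuous_legendre_mul (k j : ℤ) :
    Continuous fun q : ℝ × ℝ => legendre k q.1 * legendre j q.2 := by
  have h1 := continuous_legendre k
  have h2 := continuous_legendre j
  fun_prop

theorem logSquare_legendreInt_left (k : ℕ) (j : ℤ) (z : ℂ) :
    logSquare (fun s t => legendreInt k s * legendre j t) z =
      (L2 ((k : ℤ) + 1) j z - L2 ((k : ℤ) - 1) j z) / (2 * (k : ℂ) + 1) := by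
  have h := logSquare_linear z (f := fun s t => legendre ((k : ℤ) + 1) s * legendre j t)
    (continuous_legendre_mul ((k : ℤ) + 1) j)
    (g := fun s t => legendre ((k : ℤ) - 1) s * legendre j t)
    (continuous_legendre_mul ((k : ℤ) - 1) j) (1 / (2 * (k : ℝ) + 1)) (-1 / (2 * (k : ℝ) + 1))
  rw [L2, L2]
  push_cast at h
  rw [show (fun s t => legendreInt k s * legendre j t) = _ from ?_, h]
  · ring
  · ext s t; rw [legendreInt_eq]; ring

theorem logSquare_legendreInt_right (k : ℤ) (j : ℕ) (z : ℂ) :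
    logSquare (fun s t => legendre k s * legendreInt j t) z =
      (L2 k ((j : ℤ) + 1) z - L2 k ((j : ℤ) - 1) z) / (2 * (j : ℂ) + 1) := by
  have h := logSquare_linear z (f := fun s t => legendre k s * legendre ((j : ℤ) + 1) t)
    (continuous_legendre_mul k ((j : ℤ) + 1))
    (g := fun s t => legendre k s * legendre ((j : ℤ) - 1) t)
    (continuous_legendre_mul k ((j : ℤ) - 1)) (1 / (2 * (j : ℝ) + 1)) (-1 / (2 * (j : ℝ) + 1))
  rw [L2, L2]
  push_cast at h
  rw [show (fun s t => legendre k s * legendreInt j t) = _ from ?_, h]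
  · ring
  · ext s t; rw [legendreInt_eq]; ring

theorem logSquare_fst_mul_legendre (k : ℕ) (j : ℤ) (z : ℂ) :
    logSquare (fun s t => s * (legendre k s * legendre j t)) z =
      ((k + 1) * L2 ((k : ℤ) + 1) j z + k * L2 ((k : ℤ) - 1) j z) / (2 * (k : ℂ) + 1) := by
  have h := logSquare_linear z (f := fun s t => legendre ((k : ℤ) + 1) s * legendre j t)
    (continuous_legendre_mul ((k : ℤ) + 1) j)
    (g := fun s t => legendre ((k : ℤ) - 1) s * legendre j t)
    (continuous_legendre_mul ((k : ℤ) - 1) j) ((k + 1) / (2 * (k : ℝ) + 1)) (k / (2 * (k : ℝ) + 1))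
  rw [L2, L2]
  push_cast at h
  rw [show (fun s t => s * (legendre k s * legendre j t)) = _ from ?_, h]
  · ring
  · ext s t; rw [← mul_assoc, mul_legendre]; ring

theorem logSquare_snd_mul_legendre (k : ℤ) (j : ℕ) (z : ℂ) :
    logSquare (fun s t => t * (legendre k s * legendre j t)) z =
      ((j + 1) * L2 k ((j : ℤ) + 1) z + j * L2 k ((j : ℤ) - 1) z) / (2 * (j : ℂ) + 1) := by
  have h := logSquare_linear z (f := fun s t => legendre k s * legendre ((j : ℤ) + 1) t)
    (continuous_legendre_mul k ((j : ℤ) + 1))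
    (g := fun s t => legendre k s * legendre ((j : ℤ) - 1) t)
    (continuous_legendre_mul k ((j : ℤ) - 1)) ((j + 1) / (2 * (j : ℝ) + 1)) (j / (2 * (j : ℝ) + 1))
  rw [L2, L2]
  push_cast at h
  rw [show (fun s t => t * (legendre k s * legendre j t)) = _ from ?_, h]
  · ring
  · ext s t; rw [mul_left_comm, mul_legendre]; ring

end SquareLog

theorem mainTheorem10 :
    (∀ (k : ℕ) (z : ℂ),
      z * SquareLog.L2 (k : ℤ) 0 z =
        (((k : ℂ) - 2) / (2 * (k : ℂ) + 1)) * SquareLog.L2 ((k : ℤ) - 1) 0 z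
        + (((k : ℂ) + 3) / (2 * (k : ℂ) + 1)) * SquareLog.L2 ((k : ℤ) + 1) 0 z
        + 2 * SquareLog.F1 k 0 z - SquareLog.F2 k 0 z) ∧
    (∀ (j : ℕ) (z : ℂ),
      z * SquareLog.L2 0 (j : ℤ) z =
        Complex.I * (((j : ℂ) - 2) / (2 * (j : ℂ) + 1)) * SquareLog.L2 0 ((j : ℤ) - 1) z
        + Complex.I * (((j : ℂ) + 3) / (2 * (j : ℂ) + 1)) * SquareLog.L2 0 ((j : ℤ) + 1) z
        + 2 * SquareLog.F2 0 j z - SquareLog.F1 0 j z) := by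
  open SquareLog in
  have hneg : ∀ x, legendre (-1) x = 0 := fun x => by simp [legendre]
  -- This is `z = w + s + i t` integrated, with both multiplications expanded.
  have key : ∀ (k j : ℕ) (z : ℂ), z * L2 k j z =
      mulLogSquare (fun s t => legendre k s * legendre j t) z
        + ((k + 1) * L2 ((k : ℤ) + 1) j z + k * L2 ((k : ℤ) - 1) j z) / (2 * (k : ℂ) + 1)
        + Complex.I * (((j + 1) * L2 k ((j : ℤ) + 1) z + j * L2 k ((j : ℤ) - 1) z)
          / (2 * (j : ℂ) + 1)) := fun k j z => by
    rw [L2, mul_logSquare z (continuous_legendre_mul k j), logSquare_fst_mul_legendre,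
      logSquare_snd_mul_legendre]
  have hl := fun k j z => mulLogSquare_legendre_left k j z
  have hr := fun k j z => mulLogSquare_legendre_right k j z
  simp only [logSquare_legendreInt_left] at hl
  simp only [logSquare_legendreInt_right] at hr
  have z1 : ∀ (k : ℤ) z, L2 k (-1) z = 0 := fun k z => by simp [L2, logSquare, hneg]
  have z2 : ∀ (j : ℤ) z, L2 (-1) j z = 0 := fun j z => by simp [L2, logSquare, hneg]
  constructor
  · intro k z
    have a := key k 0 z
    have b := hl k 0 z
    have c := hr k 0 z
    simp [z1] at a b c
    -- `A` occurs once in `a`; subtracting `c` trades `i L_{k1}` for a second `A`, and `2 * b`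
    -- evaluates both.
    linear_combination a + 2 * b - c
  · intro j z
    have a := key 0 j z
    have b := hl 0 j z
    have c := hr 0 j z
    simp [z2] at a b c
    -- Here `b` trades `L_{1j}` for a second `A`, and `2 * c` evaluates both.
    linear_combination a - b + 2 * c
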